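/- **Model.** There are $N$ pages, and integers $2\le l\le k\le N$. A query sequence $\sigma=(Q_1,\dots,Q_T)$ (of any finite length $T$) consists of sets $Q_t$ of at most $l$ pages. *Single cache.* A cache of size $k$ holds a set $C_t$ of exactly $k$ pages when $Q_t$ arrives. If $Q_t\subseteq C_t$ (a hit), there is no cost and $C_{t+1}=C_t$. Otherwise (a miss) the cost is $1$, and the cache is updated to some $C_{t+1}$ with $|C_{t+1}|=k$ and $Q_t\subseteq C_{t+1}\subseteq C_t\cup Q_t$. Let $\mathrm{OPT}(\sigma)$ be the minimum number of misses on $\sigma$ over all such sequences $C_1,\dots,C_{T+1}$, chosen with knowledge of all of $\sigma$ and with any initial content $C_1$. *$m$ caches.* Each of $m$ caches holds a set $C_t^i$ of exactly $k$ pages. If $Q_t\subseteq C_t^i$ for some $i$ (a hit), there is no cost and no cache changes. Otherwise (a miss) the cost is $1$, and the caches are updated to $C_{t+1}^1,\dots,C_{t+1}^m$, again of size $k$, such that $C_{t+1}^i\subseteq C_t^i\cup Q_t$ for every $i$ and $Q_t\subseteq C_{t+1}^i$ for at least one $i$. A randomized distributed caching algorithm fixes the initial contents and makes every update at random, depending only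 on the queries up to and including the present one and on its own earlier random choices, not on later queries. It has competitive ratio $r$ if there is a constant $c$, independent of $\sigma$, such that its expected number of misses satisfies $\mathbb{E}[\mathrm{ALG}(\sigma)]\le r\cdot\mathrm{OPT}(\sigma)+c$ for every query sequence $\sigma$; the benchmark $\mathrm{OPT}$ has a single cache of the same size $k$. **Theorem.** For all integers $2\le l\le k\le N$ and $m=l+1$ caches of size $k$ there is a randomized distributed caching algorithm with competitive ratio $$r=2l\left(\ln(2l+1)-\ln\ln l+\tfrac12\right).$$ -/

import Mathlib

open scoped ENNReal

/-- The content of one cache, or one query: a finite set of pages among `N` pages. -/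
abbrev PageSet (N : ℕ) : Type := Finset (Fin N)

namespace SingleCache

/-- The unit cost of a cache miss: some page of `Q` is missing from the cache content `C`. -/
def missCost {N : ℕ} (C Q : PageSet N) : ℕ := if Q ⊆ C then 0 else 1

/-- Admissible change of the cache content `C` to `C'` when `Q` is requested: nothing changes on
a hit; on a miss the query is inserted, and apart from that pages are only evicted. -/
def IsUpdate {N : ℕ} (C Q C' : PageSet N) : Prop :=
  if Q ⊆ C then C' = C else Q ⊆ C' ∧ C' ⊆ C ∪ Q

/-- `C t` is the content of a cache of size `k` just before the `t`-th query of `σ` (counted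
from `0`); the whole of `σ` is known in advance. -/
def IsSchedule {N : ℕ} (k : ℕ) (σ : List (PageSet N)) (C : ℕ → PageSet N) : Prop :=
  (∀ t, (C t).card = k) ∧ ∀ t (ht : t < σ.length), IsUpdate (C t) σ[t] (C (t + 1))

/-- The number of cache misses of the schedule `C` on `σ`. -/
def scheduleCost {N : ℕ} (σ : List (PageSet N)) (C : ℕ → PageSet N) : ℕ :=
  ∑ t : Fin σ.length, missCost (C t) σ[t]

/-- The cost of an optimal offline algorithm with a single cache of size `k` on `σ`. -/
noncomputable def opt {N : ℕ} (k : ℕ) (σ : List (PageSet N)) : ℕ :=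
  sInf {n | ∃ C : ℕ → PageSet N, IsSchedule k σ C ∧ scheduleCost σ C = n}

theorem exists_isUpdate {N k : ℕ} (C Q : PageSet N) (hC : C.card = k) (hQ : Q.card ≤ k) :
    ∃ C' : PageSet N, C'.card = k ∧ IsUpdate C Q C' := by
  by_cases h : Q ⊆ C
  · exact ⟨C, hC, by simp [IsUpdate, h]⟩
  · obtain ⟨C', h1, h2, h3⟩ := Finset.exists_subsuperset_card_eq
      (Finset.subset_union_right : Q ⊆ C ∪ Q) hQ
      (hC.symm.le.trans (Finset.card_le_card Finset.subset_union_left))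
    exact ⟨C', h3, by simp [IsUpdate, h, h1, h2]⟩

/-- Schedules exist from every initial content, so the infimum in `opt` is attained. -/
theorem exists_isSchedule {N k : ℕ} (σ : List (PageSet N)) (hσ : ∀ Q ∈ σ, Q.card ≤ k)
    (C₀ : PageSet N) (hC₀ : C₀.card = k) :
    ∃ C : ℕ → PageSet N, C 0 = C₀ ∧ IsSchedule k σ C := by
  induction σ generalizing C₀ with
  | nil => exact ⟨fun _ => C₀, rfl, fun _ => hC₀, fun t ht => by simp at ht⟩
  | cons Q σ ih =>
    obtain ⟨C₁, h1, h2⟩ := exists_isUpdate C₀ Q hC₀ (hσ Q (by simp))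
    obtain ⟨C, hC, hs, hu⟩ := ih (fun P hP => hσ P (by simp [hP])) C₁ h1
    refine ⟨fun t => Nat.casesOn t C₀ C, rfl, ?_, ?_⟩
    · rintro (_ | t)
      · exact hC₀
      · exact hs t
    · rintro (_ | t) ht
      · simpa [hC] using h2
      · simpa using hu t (by simpa using ht)

theorem exists_scheduleCost_eq_opt {N k : ℕ} (hk : k ≤ N) (σ : List (PageSet N))
    (hσ : ∀ Q ∈ σ, Q.card ≤ k) :
    ∃ C : ℕ → PageSet N, IsSchedule k σ C ∧ scheduleCost σ C = opt k σ := by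
  obtain ⟨C₀, -, hC₀⟩ := Finset.exists_subset_card_eq
    (s := (Finset.univ : PageSet N)) (n := k) (by simpa using hk)
  obtain ⟨C, -, hC⟩ := exists_isSchedule σ hσ C₀ hC₀
  exact Nat.sInf_mem
    (s := {n | ∃ C : ℕ → PageSet N, IsSchedule k σ C ∧ scheduleCost σ C = n})
    ⟨_, C, hC, rfl⟩

end SingleCache

namespace Distributed

/-- A query is a hit for `m` caches if one of them contains the whole query. -/
def IsHit {N m : ℕ} (C : Fin m → PageSet N) (Q : PageSet N) : Prop := ∃ i, Q ⊆ C i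

open Classical in
/-- The unit cost of a cache miss: no cache contains the whole query. -/
noncomputable def missCost {N m : ℕ} (C : Fin m → PageSet N) (Q : PageSet N) : ℕ :=
  if IsHit C Q then 0 else 1

/-- Admissible change of the `m` cache contents when `Q` is requested: nothing changes on a hit;
on a miss the query is made available in one of the caches, and no cache receives any page
outside the query. -/
def IsUpdate {N m : ℕ} (C : Fin m → PageSet N) (Q : PageSet N) (C' : Fin m → PageSet N) : Prop :=
  (IsHit C Q → C' = C) ∧ (¬ IsHit C Q → IsHit C' Q ∧ ∀ i, C' i ⊆ C i ∪ Q)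

/-- A randomized online algorithm for `m` caches of size `k` and queries of at most `l` pages
out of `N`. Its memory `State` records anything it likes about the past, and it determines the
cache contents. The next memory state is drawn from a distribution that depends only on the
present memory state and the present query. -/
structure RandAlg (N m k l : ℕ) where
  State : Type
  init : State
  caches : State → Fin m → PageSet N
  step : State → PageSet N → PMF State
  card_caches : ∀ s i, (caches s i).card = k
  isUpdate : ∀ (s : State) (Q : PageSet N), Q.card ≤ l →
    ∀ s' ∈ (step s Q).support, IsUpdate (caches s) Q (caches s')

namespace RandAlg

variable {N m k l : ℕ}

/-- The law of the number of misses when `A` serves the given queries from state `s`. -/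
noncomputable def costLawFrom (A : RandAlg N m k l) : A.State → List (PageSet N) → PMF ℕ
  | _, [] => PMF.pure 0
  | s, Q :: σ =>
      (A.step s Q).bind fun s' => (A.costLawFrom s' σ).map fun n => missCost (A.caches s) Q + n

/-- The expected number of misses of `A` on the query sequence `σ`. -/
noncomputable def expectedCost (A : RandAlg N m k l) (σ : List (PageSet N)) : ℝ≥0∞ :=
  ∑' n : ℕ, A.costLawFrom A.init σ n * (n : ℝ≥0∞)

/-- `A` has competitive ratio `r` against the optimal offline algorithm with one cache of the
same size `k`. -/
def HasCompetitiveRatio (A : RandAlg N m k l) (r : ℝ) : Prop :=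
  ∃ c : ℝ, ∀ σ : List (PageSet N), (∀ Q ∈ σ, Q.card ≤ l) →
    A.expectedCost σ ≠ ∞ ∧ (A.expectedCost σ).toReal ≤ r * (SingleCache.opt k σ : ℝ) + c

end RandAlg

end Distributed

/-! With `g = ⌊k/l⌋`, the `l + 1` caches of size `k` act as one cache of size `K = k + g`. From a
`K`-set `S` leave out pairwise disjoint `g`-sets, one per cache; there is room because `(l + 1) * g
≤ k + g`. The at most `l` pages of a query inside `S` can spoil at most `l` caches, so the query is
a hit exactly if it lies in `S` (`IsSpread.isHit_iff`), and every update of `S` can be followed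
(`IsSpread.exists_isUpdate`). It remains to serve the queries with one cache of size `K` against an
offline cache of size `k`.

The large cache runs the marking algorithm, evicting by a random permutation drawn once. Let `O` be
the pages of the previous phase and `M` the marked ones. By symmetry an unmarked page of `O` is
absent with probability `|M \ O| / |O \ M|` (`missProb_of_old`), so a complete phase with `n` new
pages has at most `n (1 + H_K - H_n)` expected misses. This is at most `Y (n + g)` as soon as `Y +
log Y ≥ log (2l + 1)` (`Real.mul_one_add_log_le`), because `K ≤ (2l + 1) g`.

The potential `IsCredit` pays for these misses with `2Y` per page loaded offline. A phase can be
closed (`IsCredit.newPhase`) because all `K` marked pages were in the offline cache at some time,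
while at least `g` of them do not fit into it at the end. An offline miss loads at most `l` pages,
which gives the ratio `2 l Y`. -/

/-! ### Enlarging disjoint sets. -/

/-- Pairwise disjoint small subsets of a large enough set can be enlarged to pairwise disjoint
subsets of a prescribed common size. -/
theorem Finset.exists_disjoint_extension {α ι : Type*} [DecidableEq α] [Fintype ι]
    [DecidableEq ι] (S : Finset α) (g : ℕ) (hg : Fintype.card ι * g ≤ S.card)
    (A : ι → Finset α) (hAS : ∀ i, A i ⊆ S) (hA : ∀ i, (A i).card ≤ g)
    (hd : ∀ i j, i ≠ j → Disjoint (A i) (A j)) :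
    ∃ B : ι → Finset α, (∀ i, A i ⊆ B i) ∧ (∀ i, B i ⊆ S) ∧ (∀ i, (B i).card = g) ∧
      ∀ i j, i ≠ j → Disjoint (B i) (B j) := by
  -- The induction is on the total number of elements still lacking; each step adds one unused
  -- element of `S` to one set that is too small.
  induction hn : Fintype.card ι * g - ∑ i, (A i).card generalizing A with
  | zero =>
    refine ⟨A, fun i => subset_rfl, hAS, fun i => ?_, hd⟩
    have h1 : ∑ i, (A i).card ≤ ∑ _i : ι, g := Finset.sum_le_sum fun i _ => hA i
    have h2 : ∑ i, (A i).card = ∑ _i : ι, g := by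
      simp only [Finset.sum_const, Finset.card_univ, smul_eq_mul] at h1 ⊢
      omega
    exact (Finset.sum_eq_sum_iff_of_le fun i _ => hA i).1 h2 i (Finset.mem_univ i)
  | succ n ih =>
    obtain ⟨i, hi⟩ : ∃ i, (A i).card < g := by
      by_contra! h
      have h1 : ∑ _i : ι, g ≤ ∑ i, (A i).card := Finset.sum_le_sum fun i _ => h i
      simp only [Finset.sum_const, Finset.card_univ, smul_eq_mul] at h1
      omega
    have hcard : (Finset.univ.biUnion A).card = ∑ i, (A i).card :=
      Finset.card_biUnion fun i _ j _ hij => hd i j hij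
    obtain ⟨p, hpS, hp⟩ : ∃ p ∈ S, p ∉ Finset.univ.biUnion A :=
      Finset.exists_mem_notMem_of_card_lt_card (by omega)
    simp only [Finset.mem_biUnion, Finset.mem_univ, true_and, not_exists] at hp
    obtain ⟨B, h1, h2, h3, h4⟩ := ih (Function.update A i (insert p (A i)))
      (by
        intro j
        by_cases hj : j = i
        · subst hj; simpa [Finset.insert_subset_iff, hpS] using hAS j
        · simpa [hj] using hAS j)
      (by
        intro j
        by_cases hj : j = i
        · subst hj; simpa [hp j] using hi
        · simpa [hj] using hA j)
      (by
        intro a b hab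
        by_cases ha : a = i
        · subst ha
          simpa [hab.symm, hp b] using hd a b hab
        · by_cases hb : b = i
          · subst hb
            simpa [ha, hp a] using hd a b hab
          · simpa [ha, hb] using hd a b hab)
      (by
        have h : ∑ j, (Function.update A i (insert p (A i)) j).card = ∑ j, (A j).card + 1 := by
          rw [← Finset.add_sum_erase _ _ (Finset.mem_univ i),
            ← Finset.add_sum_erase (a := i) _ (fun j => (A j).card) (Finset.mem_univ i),
            Finset.sum_congr rfl (g := fun j => (A j).card)
              fun j hj => by simp [(Finset.mem_erase.1 hj).1]]
          simp [hp i]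
          omega
        omega)
    refine ⟨B, fun j => ?_, h2, h3, h4⟩
    by_cases hj : j = i
    · subst hj
      exact (Finset.subset_insert p (A j)).trans (by simpa using h1 j)
    · simpa [hj] using h1 j

/-! ### Random mixtures of deterministic algorithms. -/

namespace Distributed

variable {N m k l : ℕ}

/-- A deterministic online algorithm for `m` caches of size `k` and queries of at most `l`
pages. -/
structure DetAlg (N m k l : ℕ) where
  State : Type
  init : State
  caches : State → Fin m → PageSet N
  step : State → PageSet N → State
  card_caches : ∀ s i, (caches s i).card = k
  isUpdate : ∀ (s : State) (Q : PageSet N), Q.card ≤ l →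
    IsUpdate (caches s) Q (caches (step s Q))

namespace DetAlg

/-- The number of misses when `A` serves the given queries from state `s`. -/
noncomputable def costFrom (A : DetAlg N m k l) : A.State → List (PageSet N) → ℕ
  | _, [] => 0
  | s, Q :: σ => missCost (A.caches s) Q + A.costFrom (A.step s Q) σ

variable {Ω : Type} [Fintype Ω] [Nonempty Ω]

/-- The randomized algorithm that picks one of finitely many deterministic algorithms with the
same initial contents uniformly at random, and follows it. -/
noncomputable def mix (A : Ω → DetAlg N m k l) (C₀ : Fin m → PageSet N)
    (hC₀ : ∀ ω, (A ω).caches (A ω).init = C₀) : RandAlg N m k l where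
  State := Option (Σ ω, (A ω).State)
  -- The initial state is deterministic, so the draw of `ω` waits for the first query; hence all
  -- members must share the contents `C₀`.
  init := none
  caches s := s.elim C₀ fun x => (A x.1).caches x.2
  step s Q := s.elim
    ((PMF.uniformOfFintype Ω).map fun ω => some ⟨ω, (A ω).step (A ω).init Q⟩)
    fun x => PMF.pure (some ⟨x.1, (A x.1).step x.2 Q⟩)
  card_caches s i := by
    rcases s with _ | x
    · obtain ⟨ω⟩ := ‹Nonempty Ω›
      simpa [← hC₀ ω] using (A ω).card_caches _ i
    · exact (A x.1).card_caches _ i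
  isUpdate s Q hQ s' hs' := by
    rcases s with _ | x
    · simp only [Option.elim_none, PMF.support_map, Set.mem_image] at hs'
      obtain ⟨ω, -, rfl⟩ := hs'
      simpa [hC₀ ω] using (A ω).isUpdate (A ω).init Q hQ
    · simp only [Option.elim_some, PMF.support_pure, Set.mem_singleton_iff] at hs'
      subst hs'
      exact (A x.1).isUpdate x.2 Q hQ

theorem costLawFrom_mix_some (A : Ω → DetAlg N m k l) (C₀ : Fin m → PageSet N)
    (hC₀ : ∀ ω, (A ω).caches (A ω).init = C₀) (σ : List (PageSet N)) (ω : Ω)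
    (s : (A ω).State) :
    (mix A C₀ hC₀).costLawFrom (some ⟨ω, s⟩) σ = PMF.pure ((A ω).costFrom s σ) := by
  induction σ generalizing s with
  | nil => rfl
  | cons Q σ ih =>
    simp only [RandAlg.costLawFrom, costFrom]
    refine (PMF.pure_bind _ _).trans ?_
    rw [ih, PMF.pure_map]
    rfl

theorem costLawFrom_mix_init (A : Ω → DetAlg N m k l) (C₀ : Fin m → PageSet N)
    (hC₀ : ∀ ω, (A ω).caches (A ω).init = C₀) (σ : List (PageSet N)) :
    (mix A C₀ hC₀).costLawFrom (mix A C₀ hC₀).init σ =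
      (PMF.uniformOfFintype Ω).map fun ω => (A ω).costFrom (A ω).init σ := by
  cases σ with
  | nil => exact (PMF.map_const _ _).symm
  | cons Q σ =>
    simp only [RandAlg.costLawFrom, costFrom]
    refine (PMF.bind_map _ _ _).trans ?_
    rw [← PMF.bind_pure_comp]
    congr 1
    funext ω
    refine (congrArg (PMF.map _) (costLawFrom_mix_some A C₀ hC₀ σ ω _)).trans ?_
    rw [PMF.pure_map, Function.comp_apply, hC₀ ω]
    rfl

/-- The expected cost of the mixture is the average of the costs. -/
theorem expectedCost_mix (A : Ω → DetAlg N m k l) (C₀ : Fin m → PageSet N)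
    (hC₀ : ∀ ω, (A ω).caches (A ω).init = C₀) (σ : List (PageSet N)) :
    (mix A C₀ hC₀).expectedCost σ =
      ENNReal.ofReal ((∑ ω, ((A ω).costFrom (A ω).init σ : ℝ)) / Fintype.card Ω) := by
  have hpos : (0 : ℝ) < Fintype.card Ω := by exact_mod_cast Fintype.card_pos
  unfold RandAlg.expectedCost
  rw [costLawFrom_mix_init]
  simp only [PMF.map_apply, ← ENNReal.tsum_mul_right]
  rw [ENNReal.tsum_comm, tsum_fintype, Finset.sum_div,
    ENNReal.ofReal_sum_of_nonneg fun _ _ => by positivity]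
  refine Finset.sum_congr rfl fun ω _ => ?_
  rw [tsum_eq_single ((A ω).costFrom (A ω).init σ) fun n hn => by simp [hn]]
  rw [ENNReal.ofReal_div_of_pos hpos]
  simp [div_eq_mul_inv, mul_comm]

end DetAlg

/-! ### Spreading one large cache over `l + 1` small ones. -/

/-- Caches of size `k` jointly representing the large cache `S`: they hold only pages of `S`, and
every page of `S` is missing from at most one of them. -/
structure IsSpread (k : ℕ) (S : PageSet N) (C : Fin m → PageSet N) : Prop where
  card_eq : ∀ i, (C i).card = k
  subset : ∀ i, C i ⊆ S
  eq_of_notMem : ∀ p ∈ S, ∀ i j, p ∉ C i → p ∉ C j → i = j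

namespace IsSpread

/-- Pigeonhole: if every cache lacked some page of `Q ⊆ S`, these `l + 1` pages would be distinct,
since a page of `S` is missing from at most one cache. -/
theorem isHit_iff {S : PageSet N} {C : Fin (l + 1) → PageSet N} (h : IsSpread k S C)
    {Q : PageSet N} (hQ : Q.card ≤ l) : IsHit C Q ↔ Q ⊆ S := by
  refine ⟨fun ⟨i, hi⟩ => hi.trans (h.subset i), fun hQS => ?_⟩
  by_contra hmiss
  simp only [IsHit, not_exists, Finset.not_subset] at hmiss
  choose f hfQ hf using hmiss
  have hinj : Set.InjOn f (Finset.univ : Finset (Fin (l + 1))) := fun i _ j _ hij =>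
    h.eq_of_notMem (f i) (hQS (hfQ i)) i j (hf i) (hij ▸ hf j)
  have := Finset.card_le_card_of_injOn f (s := Finset.univ) (t := Q) (fun i _ => hfQ i) hinj
  simp at this
  omega

/-- Caches obtained by leaving out pairwise disjoint sets that contain the given ones. -/
theorem exists_of_missing {S : PageSet N} (g : ℕ) (hS : S.card = k + g) (hg : m * g ≤ S.card)
    (A : Fin m → PageSet N) (hAS : ∀ i, A i ⊆ S) (hA : ∀ i, (A i).card ≤ g)
    (hd : ∀ i j, i ≠ j → Disjoint (A i) (A j)) :
    ∃ C : Fin m → PageSet N, IsSpread k S C ∧ ∀ i, C i ⊆ S \ A i := by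
  obtain ⟨B, h1, h2, h3, h4⟩ :=
    Finset.exists_disjoint_extension S g (by simpa using hg) A hAS hA hd
  refine ⟨fun i => S \ B i, ⟨fun i => ?_, fun i => Finset.sdiff_subset, ?_⟩,
    fun i => Finset.sdiff_subset_sdiff subset_rfl (h1 i)⟩
  · rw [Finset.card_sdiff_of_subset (h2 i), h3, hS, Nat.add_sub_cancel]
  · intro p hp i j hi hj
    simp only [Finset.mem_sdiff, hp, true_and, not_not] at hi hj
    by_contra hij
    exact Finset.disjoint_left.1 (h4 i j hij) hi hj

theorem exists_of_card {S : PageSet N} (g : ℕ) (hS : S.card = k + g) (hg : m * g ≤ S.card) :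
    ∃ C : Fin m → PageSet N, IsSpread k S C := by
  obtain ⟨C, hC, -⟩ := exists_of_missing g hS hg (fun _ => ∅) (by simp) (by simp) (by simp)
  exact ⟨C, hC⟩

/-- Every admissible change of the large cache can be followed by the small ones. -/
theorem exists_isUpdate {S S' : PageSet N} {C : Fin (l + 1) → PageSet N} (h : IsSpread k S C)
    (g : ℕ) (hg : l * g ≤ k) (hS : S.card = k + g) (hS' : S'.card = k + g) {Q : PageSet N}
    (hQ : Q.card ≤ l) (hu : SingleCache.IsUpdate S Q S') :
    ∃ C' : Fin (l + 1) → PageSet N, IsSpread k S' C' ∧ IsUpdate C Q C' := by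
  unfold SingleCache.IsUpdate at hu
  split_ifs at hu with hQS
  · subst hu
    exact ⟨C, h, fun _ => rfl, fun hn => absurd ((h.isHit_iff hQ).2 hQS) hn⟩
  · obtain ⟨hQS', hsub⟩ := hu
    -- Cache `i` must omit `S' \ (C i ∪ Q)`, the pages it is not allowed to receive. These sets lie
    -- inside the old omitted sets `S \ C i`, so they are disjoint and of size at most `g`, and can
    -- be enlarged to the new omitted sets.
    have hmiss : ∀ i, ∀ p ∈ S' \ (C i ∪ Q), p ∈ S \ C i := by
      intro i p hp
      have := @hsub p
      simp only [Finset.mem_sdiff, Finset.mem_union] at hp this ⊢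
      tauto
    obtain ⟨C', hC', hsub'⟩ := exists_of_missing (m := l + 1) (S := S') g hS'
      (by rw [hS']; linarith) (fun i => S' \ (C i ∪ Q))
      (fun i => Finset.sdiff_subset)
      (fun i => (Finset.card_le_card (hmiss i)).trans (by
        rw [Finset.card_sdiff_of_subset (h.subset i), h.card_eq, hS, Nat.add_sub_cancel_left]))
      (fun i j hij => Finset.disjoint_left.2 fun p hi hj => by
        have hi' := Finset.mem_sdiff.1 (hmiss i p hi)
        have hj' := Finset.mem_sdiff.1 (hmiss j p hj)
        exact hij (h.eq_of_notMem p hi'.1 i j hi'.2 hj'.2))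
    refine ⟨C', hC', fun hh => absurd ((h.isHit_iff hQ).1 hh) hQS,
      fun _ => ⟨(hC'.isHit_iff hQ).2 hQS', fun i p hp => ?_⟩⟩
    have := hsub' i hp
    simp only [Finset.mem_sdiff, not_and, not_not] at this
    exact this.2 this.1

end IsSpread

end Distributed

namespace SingleCache

variable {N : ℕ}

/-- A deterministic online algorithm for a single cache of size `K` and queries of at most `l`
pages. -/
structure OnlineAlg (N K l : ℕ) where
  State : Type
  init : State
  content : State → PageSet N
  step : State → PageSet N → State
  card_content : ∀ s, (content s).card = K
  isUpdate : ∀ (s : State) (Q : PageSet N), Q.card ≤ l →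
    IsUpdate (content s) Q (content (step s Q))

namespace OnlineAlg

variable {K k l g : ℕ}

/-- The number of misses when `A` serves the given queries from state `s`. -/
def costFrom (A : OnlineAlg N K l) : A.State → List (PageSet N) → ℕ
  | _, [] => 0
  | s, Q :: σ => missCost (A.content s) Q + A.costFrom (A.step s Q) σ

open Classical in
/-- Simulation of a cache of size `k + g` by `l + 1` caches of size `k`. -/
noncomputable def distribute (A : OnlineAlg N (k + g) l) (hg : l * g ≤ k)
    (C₀ : Fin (l + 1) → PageSet N) (hC₀ : Distributed.IsSpread k (A.content A.init) C₀) :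
    Distributed.DetAlg N (l + 1) k l where
  State := {x : A.State × (Fin (l + 1) → PageSet N) //
    Distributed.IsSpread k (A.content x.1) x.2}
  init := ⟨(A.init, C₀), hC₀⟩
  caches x := x.1.2
  step x Q :=
    if hQ : Q.card ≤ l then
      have h := x.2.exists_isUpdate g hg (A.card_content _) (A.card_content _) hQ
        (A.isUpdate x.1.1 Q hQ)
      ⟨(A.step x.1.1 Q, h.choose), h.choose_spec.1⟩
    -- Oversized queries never occur; the default only makes `step` total.
    else x
  card_caches x i := x.2.card_eq i
  isUpdate x Q hQ := by
    have h := x.2.exists_isUpdate g hg (A.card_content _) (A.card_content _) hQ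
        (A.isUpdate x.1.1 Q hQ)
    simpa [hQ] using h.choose_spec.2

theorem costFrom_distribute (A : OnlineAlg N (k + g) l) (hg : l * g ≤ k)
    (C₀ : Fin (l + 1) → PageSet N) (hC₀ : Distributed.IsSpread k (A.content A.init) C₀)
    (σ : List (PageSet N)) (hσ : ∀ Q ∈ σ, Q.card ≤ l) (x : (A.distribute hg C₀ hC₀).State) :
    (A.distribute hg C₀ hC₀).costFrom x σ = A.costFrom x.1.1 σ := by
  induction σ generalizing x with
  | nil => rfl
  | cons Q σ ih =>
    have hQ : Q.card ≤ l := hσ Q (by simp)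
    simp only [Distributed.DetAlg.costFrom, costFrom]
    rw [ih (fun P hP => hσ P (by simp [hP]))]
    congr 1
    · have := x.2.isHit_iff hQ
      simp only [Distributed.missCost, missCost, distribute, this]
    · exact congrArg (fun y : (A.distribute hg C₀ hC₀).State => A.costFrom y.1.1 σ) (dif_pos hQ)

/-- A finite family of online algorithms for a single cache of size `k + g` yields a randomized
algorithm for `l + 1` caches of size `k` whose expected cost is the average of theirs. -/
theorem exists_randAlg {Ω : Type} [Fintype Ω] [Nonempty Ω] (hg : l * g ≤ k)
    (A : Ω → OnlineAlg N (k + g) l) (S₀ : PageSet N) (hS₀ : ∀ ω, (A ω).content (A ω).init = S₀) :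
    ∃ B : Distributed.RandAlg N (l + 1) k l, ∀ σ : List (PageSet N), (∀ Q ∈ σ, Q.card ≤ l) →
      B.expectedCost σ =
        ENNReal.ofReal ((∑ ω, ((A ω).costFrom (A ω).init σ : ℝ)) / Fintype.card Ω) := by
  have hcard : S₀.card = k + g := by
    obtain ⟨ω⟩ := ‹Nonempty Ω›
    rw [← hS₀ ω, (A ω).card_content]
  obtain ⟨C₀, hC₀⟩ := Distributed.IsSpread.exists_of_card (m := l + 1) g hcard
    (by rw [hcard]; linarith)
  refine ⟨Distributed.DetAlg.mix
    (fun ω => (A ω).distribute hg C₀ ((hS₀ ω).symm ▸ hC₀)) C₀ fun ω => rfl, fun σ hσ => ?_⟩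
  refine (Distributed.DetAlg.expectedCost_mix _ _ _ σ).trans ?_
  simp only [costFrom_distribute _ hg _ _ σ hσ]
  rfl

end OnlineAlg

end SingleCache

/-! ### The marking algorithm with a random eviction order. -/

namespace Marking

variable {N : ℕ}

/-- The first `j` pages of `A` in the order given by `π`. -/
def top (π : Equiv.Perm (Fin N)) (j : ℕ) (A : PageSet N) : PageSet N :=
  A.filter fun p => (A.filter fun q => π q < π p).card < j

theorem mem_top {π : Equiv.Perm (Fin N)} {j : ℕ} {A : PageSet N} {p : Fin N} :
    p ∈ top π j A ↔ p ∈ A ∧ (A.filter fun q => π q < π p).card < j :=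
  Finset.mem_filter

theorem top_subset (π : Equiv.Perm (Fin N)) (j : ℕ) (A : PageSet N) : top π j A ⊆ A :=
  Finset.filter_subset _ _

/-- The rank within `A` is a bijection from `A` onto `range A.card`, and `top` collects the ranks
below `j`. -/
theorem card_top (π : Equiv.Perm (Fin N)) {j : ℕ} {A : PageSet N} (hj : j ≤ A.card) :
    (top π j A).card = j := by
  set r : Fin N → ℕ := fun p => (A.filter fun q => π q < π p).card with hr
  have hmono : ∀ p ∈ A, ∀ q, π p < π q → r p < r q := fun p hp q hpq =>
    Finset.card_lt_card ⟨Finset.monotone_filter_right _ fun x _ hx => lt_trans hx hpq,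
      fun h => by simpa using h (Finset.mem_filter.2 ⟨hp, hpq⟩)⟩
  have hinj : Set.InjOn r A := fun p hp q hq hpq => by
    rcases lt_trichotomy (π p) (π q) with h | h | h
    · exact absurd hpq (hmono p hp q h).ne
    · exact π.injective h
    · exact absurd hpq (hmono q hq p h).ne'
  have himg : A.image r = Finset.range A.card := by
    apply Finset.eq_of_subset_of_card_le
    · intro x hx
      obtain ⟨p, hp, rfl⟩ := Finset.mem_image.1 hx
      exact Finset.mem_range.2 (Finset.card_lt_card ⟨Finset.filter_subset _ _,
        fun h => by simpa using h hp⟩)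
    · rw [Finset.card_image_of_injOn hinj, Finset.card_range]
  have htop : (top π j A).image r = Finset.range j := by
    ext x
    simp only [top, Finset.mem_image, Finset.mem_filter, Finset.mem_range]
    constructor
    · rintro ⟨p, ⟨-, h⟩, rfl⟩
      exact h
    · intro hx
      have : x ∈ A.image r := by rw [himg]; exact Finset.mem_range.2 (hx.trans_le hj)
      obtain ⟨p, hp, rfl⟩ := Finset.mem_image.1 this
      exact ⟨p, ⟨hp, hx⟩, rfl⟩
  simpa [Finset.card_image_of_injOn (hinj.mono (Finset.coe_subset.2 (top_subset π j A)))]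
    using congrArg Finset.card htop

theorem top_erase_subset (π : Equiv.Perm (Fin N)) (j : ℕ) (A : PageSet N) (p : Fin N) :
    top π j (A.erase p) ⊆ top π (j + 1) A := by
  intro q hq
  rw [mem_top, Finset.mem_erase] at hq
  rw [mem_top]
  refine ⟨hq.1.2, lt_of_le_of_lt ?_ (Nat.succ_lt_succ hq.2)⟩
  rw [Finset.filter_erase]
  have := Finset.pred_card_le_card_erase (s := A.filter fun x => π x < π q) (a := p)
  omega

theorem mem_top_mul_swap (π : Equiv.Perm (Fin N)) (j : ℕ) {A : PageSet N} {p q : Fin N}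
    (hp : p ∈ A) (hq : q ∈ A) : p ∈ top (π * Equiv.swap p q) j A ↔ q ∈ top π j A := by
  have hA : ∀ x, Equiv.swap p q x ∈ A ↔ x ∈ A := by
    intro x
    by_cases h1 : x = p
    · subst h1; simp [hp, hq]
    · by_cases h2 : x = q
      · subst h2; simp [hp, hq]
      · rw [Equiv.swap_apply_of_ne_of_ne h1 h2]
  have hcard : (A.filter fun x => π (Equiv.swap p q x) < π q).card =
      (A.filter fun x => π x < π q).card := by
    refine Finset.card_bij' (fun x _ => Equiv.swap p q x) (fun x _ => Equiv.swap p q x)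
      ?_ ?_ ?_ ?_ <;> simp +contextual [hA]
  rw [mem_top, mem_top]
  simp only [hp, hq, true_and, Equiv.Perm.mul_apply, Equiv.swap_apply_left, hcard]

/-- In a random order, each page of `A` fails to be among the first `j` equally often. -/
theorem card_filter_notMem_top {j : ℕ} {A : PageSet N} (hj : j ≤ A.card) {p : Fin N}
    (hp : p ∈ A) :
    A.card * (Finset.univ.filter fun π : Equiv.Perm (Fin N) => p ∉ top π j A).card =
      Fintype.card (Equiv.Perm (Fin N)) * (A.card - j) := by
  -- Composing `π` with the transposition of `p` and `q` exchanges their roles, so the count is the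
  -- same for every page of `A`. Double counting then gives its value, as each `π` leaves out
  -- `A.card - j` pages.
  have hsym : ∀ q ∈ A, (Finset.univ.filter fun π : Equiv.Perm (Fin N) => q ∉ top π j A).card =
      (Finset.univ.filter fun π : Equiv.Perm (Fin N) => p ∉ top π j A).card := fun q hq =>
    Finset.card_equiv (Equiv.mulRight (Equiv.swap p q)) fun π => by
      simp [mem_top_mul_swap π j hp hq]
  have h1 : ∑ q ∈ A, (Finset.univ.filter fun π : Equiv.Perm (Fin N) => q ∉ top π j A).card =
      ∑ π : Equiv.Perm (Fin N), (A.filter fun q => q ∉ top π j A).card :=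
    Finset.sum_card_bipartiteAbove_eq_sum_card_bipartiteBelow fun q π => q ∉ top π j A
  rw [Finset.sum_congr rfl hsym, Finset.sum_const, smul_eq_mul] at h1
  rw [h1, Finset.sum_congr rfl (g := fun _ => A.card - j), Finset.sum_const, smul_eq_mul,
    Finset.card_univ]
  intro π _
  rw [Finset.filter_notMem_eq_sdiff, Finset.card_sdiff_of_subset (top_subset π j A), card_top π hj]

/-- The pages of the previous phase and the pages marked in the present phase. -/
abbrev Phase (N : ℕ) : Type := PageSet N × PageSet N

/-- The invariant of the marking algorithm for a cache of size `K`. -/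
def Phase.IsValid (K : ℕ) (x : Phase N) : Prop := x.1.card = K ∧ x.2.card ≤ K

/-- The cache content of the marking algorithm: the marked pages, and as many pages of the
previous phase as fit. -/
def content (K : ℕ) (π : Equiv.Perm (Fin N)) (x : Phase N) : PageSet N :=
  x.2 ∪ top π (K - x.2.card) (x.1 \ x.2)

/-- Marks a page, starting a new phase when `K` other pages are marked. -/
def mark (K : ℕ) (x : Phase N) (p : Fin N) : Phase N :=
  if p ∈ x.2 then x else if x.2.card < K then (x.1, insert p x.2) else (x.2, {p})

variable {K : ℕ} {x : Phase N} {p : Fin N}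

theorem mark_of_mem (h : p ∈ x.2) : mark K x p = x := if_pos h

theorem mark_of_lt (h : p ∉ x.2) (hK : x.2.card < K) : mark K x p = (x.1, insert p x.2) := by
  simp [mark, h, hK]

theorem mark_of_le (h : p ∉ x.2) (hK : K ≤ x.2.card) : mark K x p = (x.2, {p}) := by
  simp [mark, h, hK.not_gt]

theorem mem_mark : p ∈ (mark K x p).2 := by
  unfold mark
  split_ifs <;> simp_all

theorem Phase.IsValid.mark (hx : x.IsValid K) (hK : 0 < K) : (mark K x p).IsValid K := by
  unfold Marking.mark
  split_ifs with h1 h2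
  · exact hx
  · exact ⟨hx.1, by simpa [h1] using h2⟩
  · exact ⟨le_antisymm hx.2 (not_lt.1 h2), by rwa [Finset.card_singleton]⟩

theorem Phase.IsValid.foldl (hx : x.IsValid K) (hK : 0 < K) (ps : List (Fin N)) :
    (ps.foldl (Marking.mark K) x).IsValid K := by
  induction ps generalizing x with
  | nil => exact hx
  | cons p ps ih => exact ih (hx.mark hK)

theorem card_content (hx : x.IsValid K) (π : Equiv.Perm (Fin N)) :
    (content K π x).card = K := by
  have h1 : K - x.2.card ≤ (x.1 \ x.2).card := by
    have := Finset.le_card_sdiff x.2 x.1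
    rwa [hx.1] at this
  rw [content, Finset.card_union_of_disjoint, card_top π h1]
  · have := hx.2
    omega
  · exact Finset.disjoint_of_subset_right (top_subset _ _ _) Finset.disjoint_sdiff

theorem marked_subset_content (π : Equiv.Perm (Fin N)) : x.2 ⊆ content K π x :=
  Finset.subset_union_left

/-- Marking an old page removes it from the pool and lowers the quota by one, and a new page only
lowers the quota; by `top_erase_subset` no other page enters. When a phase starts, the cache
consists of marked pages only, and these form the new pool. -/
theorem content_mark_subset (π : Equiv.Perm (Fin N)) :
    content K π (mark K x p) ⊆ insert p (content K π x) := by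
  by_cases h1 : p ∈ x.2
  · rw [mark_of_mem h1]
    exact Finset.subset_insert _ _
  rcases lt_or_ge x.2.card K with h2 | h2
  · rw [mark_of_lt h1 h2]
    simp only [content, Finset.card_insert_of_notMem h1]
    rw [Finset.insert_union]
    refine Finset.insert_subset_insert _ (Finset.union_subset_union_right ?_)
    obtain ⟨j, hj⟩ := Nat.exists_eq_add_of_lt h2
    have e1 : K - (x.2.card + 1) = j := by omega
    have e2 : K - x.2.card = j + 1 := by omega
    have e3 : x.1 \ insert p x.2 = (x.1 \ x.2).erase p := by
      ext q; simp; tauto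
    rw [e1, e2, e3]
    exact top_erase_subset _ _ _ _
  · rw [mark_of_le h1 h2]
    simp only [content]
    refine Finset.union_subset (by simp) ((top_subset _ _ _).trans ?_)
    exact (Finset.sdiff_subset.trans (marked_subset_content π)).trans (Finset.subset_insert _ _)

theorem content_mark_of_mem (hx : x.IsValid K) (hK : 0 < K) (π : Equiv.Perm (Fin N))
    (hp : p ∈ content K π x) : content K π (mark K x p) = content K π x := by
  apply Finset.eq_of_subset_of_card_le
  · simpa [hp] using content_mark_subset (K := K) (x := x) (p := p) π
  · rw [card_content hx, card_content (hx.mark hK)]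

theorem content_foldl_subset (π : Equiv.Perm (Fin N))
    {Q : PageSet N} (ps : List (Fin N)) (hps : ∀ p ∈ ps, p ∈ Q) :
    content K π (ps.foldl (mark K) x) ⊆ content K π x ∪ Q := by
  induction ps generalizing x with
  | nil => exact Finset.subset_union_left
  | cons p ps ih =>
    refine (ih fun q hq => hps q (by simp [hq])).trans ?_
    refine Finset.union_subset ((content_mark_subset π).trans ?_) Finset.subset_union_right
    exact Finset.insert_subset (Finset.mem_union_right _ (hps p (by simp)))
      Finset.subset_union_left

theorem content_foldl_of_subset (hx : x.IsValid K) (hK : 0 < K) (π : Equiv.Perm (Fin N))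
    (ps : List (Fin N)) (hps : ∀ p ∈ ps, p ∈ content K π x) :
    content K π (ps.foldl (mark K) x) = content K π x := by
  induction ps generalizing x with
  | nil => rfl
  | cons p ps ih =>
    have h := content_mark_of_mem hx hK π (hps p (by simp))
    rw [List.foldl_cons, ih (hx.mark hK) (fun q hq => h ▸ hps q (by simp [hq])), h]

theorem foldl_mark_subset {Q : PageSet N} (ps : List (Fin N)) (hps : ∀ p ∈ ps, p ∈ Q)
    (hx : x.2 ⊆ Q) : (ps.foldl (mark K) x).2 ⊆ Q := by
  induction ps generalizing x with
  | nil => exact hx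
  | cons p ps ih =>
    refine ih (fun q hq => hps q (by simp [hq])) ?_
    have hp := hps p (by simp)
    unfold mark
    split_ifs <;> simp [Finset.insert_subset_iff, hp, hx]

/-- If the marked pages and those to be marked fit together, then all get marked. -/
theorem foldl_mark_of_card_le {Q : PageSet N} (hQ : Q.card ≤ K) (ps : List (Fin N))
    (hps : ∀ p ∈ ps, p ∈ Q) (hx : x.2 ⊆ Q) :
    x.2 ⊆ (ps.foldl (mark K) x).2 ∧ ∀ p ∈ ps, p ∈ (ps.foldl (mark K) x).2 := by
  induction ps generalizing x with
  | nil => simp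
  | cons p ps ih =>
    have hp := hps p (by simp)
    have hsub : x.2 ⊆ (mark K x p).2 := by
      by_cases h1 : p ∈ x.2
      · rw [mark_of_mem h1]
      · have h2 : x.2.card < K := by
          have := Finset.card_le_card (Finset.insert_subset hp hx)
          rw [Finset.card_insert_of_notMem h1] at this
          omega
        rw [mark_of_lt h1 h2]
        exact Finset.subset_insert _ _
    have hsub' : (mark K x p).2 ⊆ Q := foldl_mark_subset [p] (by simpa using hp) hx
    obtain ⟨h1, h2⟩ := ih (fun q hq => hps q (by simp [hq])) hsub'
    refine ⟨hsub.trans h1, fun q hq => ?_⟩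
    rcases List.mem_cons.1 hq with rfl | hq
    · exact h1 mem_mark
    · exact h2 q hq

/-- Either all pages get marked in the present phase, or a new phase has started. -/
theorem foldl_mark_or {Q : PageSet N} (ps : List (Fin N)) (hps : ∀ p ∈ ps, p ∈ Q) :
    (x.2 ⊆ (ps.foldl (mark K) x).2 ∧ ∀ p ∈ ps, p ∈ (ps.foldl (mark K) x).2) ∨
      (ps.foldl (mark K) x).2 ⊆ Q := by
  induction ps generalizing x with
  | nil => simp
  | cons p ps ih =>
    have hp := hps p (by simp)
    have hps' : ∀ q ∈ ps, q ∈ Q := fun q hq => hps q (by simp [hq])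
    rcases ih (x := mark K x p) hps' with ⟨h1, h2⟩ | h
    · by_cases h3 : x.2 ⊆ (mark K x p).2
      · refine Or.inl ⟨h3.trans h1, fun q hq => ?_⟩
        rcases List.mem_cons.1 hq with rfl | hq
        · exact h1 mem_mark
        · exact h2 q hq
      · refine Or.inr (foldl_mark_subset ps hps' ?_)
        unfold mark at h3 ⊢
        split_ifs at h3 ⊢ with h4 h5
        · exact absurd subset_rfl h3
        · exact absurd (Finset.subset_insert _ _) h3
        · simpa using hp
    · exact Or.inr h

/-- The pages of a query in the order in which they are marked. The query is repeated, so that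
all of its pages are marked in the end even if a new phase starts in between. -/
noncomputable def pages (Q : PageSet N) : List (Fin N) := Q.toList ++ Q.toList

theorem mem_pages {Q : PageSet N} : p ∈ pages Q ↔ p ∈ Q := by simp [pages]

theorem subset_foldl_pages {Q : PageSet N} (hQ : Q.card ≤ K) :
    Q ⊆ ((pages Q).foldl (mark K) x).2 := by
  rw [pages, List.foldl_append]
  have hmem : ∀ p ∈ Q.toList, p ∈ Q := by simp
  rcases foldl_mark_or (x := x) (K := K) Q.toList hmem with ⟨-, h⟩ | h
  · have hfix : ∀ ps : List (Fin N), ∀ y : Phase N, (∀ p ∈ ps, p ∈ y.2) →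
        ps.foldl (mark K) y = y := by
      intro ps y hy
      induction ps with
      | nil => rfl
      | cons p ps ih =>
        rw [List.foldl_cons, mark_of_mem (hy p (by simp)), ih fun q hq => hy q (by simp [hq])]
    rw [hfix _ _ h]
    exact fun p hp => h p (by simpa using hp)
  -- A phase started during the first pass, so only pages of `Q` are marked; as `Q.card ≤ K`, the
  -- second pass cannot start another one.
  · exact fun p hp => (foldl_mark_of_card_le hQ Q.toList hmem h).2 p (by simpa using hp)

/-- The marking algorithm that evicts pages in the order given by `π`. -/
noncomputable def alg {l : ℕ} (hK : 0 < K) (hl : l ≤ K) (π : Equiv.Perm (Fin N))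
    (S₀ : PageSet N) (hS₀ : S₀.card = K) : SingleCache.OnlineAlg N K l where
  State := {x : Phase N // x.IsValid K}
  init := ⟨(S₀, ∅), hS₀, by simp⟩
  content x := content K π x.1
  step x Q := ⟨(pages Q).foldl (mark K) x.1, x.2.foldl hK _⟩
  card_content x := card_content x.2 π
  isUpdate x Q hQ := by
    unfold SingleCache.IsUpdate
    split_ifs with h
    · exact content_foldl_of_subset x.2 hK π _ fun p hp => h (mem_pages.1 hp)
    · exact ⟨(subset_foldl_pages (hQ.trans hl)).trans (marked_subset_content π),
        content_foldl_subset π _ fun p hp => mem_pages.1 hp⟩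

/-- All of `S₀` fits into the cache whatever `π` is, so the algorithms have the common initial
content that mixing them requires. -/
theorem content_init {l : ℕ} (hK : 0 < K) (hl : l ≤ K) (π : Equiv.Perm (Fin N))
    (S₀ : PageSet N) (hS₀ : S₀.card = K) :
    (alg hK hl π S₀ hS₀).content (alg hK hl π S₀ hS₀).init = S₀ := by
  have : (alg hK hl π S₀ hS₀).content (alg hK hl π S₀ hS₀).init = top π K S₀ := by
    simp [alg, content]
  rw [this]
  exact Finset.eq_of_subset_of_card_le (top_subset _ _ _) (by rw [card_top π hS₀.ge, hS₀])

/-! ### Miss probabilities. -/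

/-- The probability that `p` is not in the cache. -/
noncomputable def missProb (K : ℕ) (x : Phase N) (p : Fin N) : ℝ :=
  (Finset.univ.filter fun π : Equiv.Perm (Fin N) => p ∉ content K π x).card /
    Fintype.card (Equiv.Perm (Fin N))

theorem missProb_le_one : missProb K x p ≤ 1 :=
  div_le_one_of_le₀ (by exact_mod_cast Finset.card_le_univ _) (by positivity)

theorem missProb_of_marked (hp : p ∈ x.2) : missProb K x p = 0 := by
  have : ∀ π : Equiv.Perm (Fin N), p ∈ content K π x := fun π => marked_subset_content π hp
  simp [missProb, this]

/-- From the pool `x.1 \ x.2` the cache keeps `K - x.2.card` pages. As `x.1` has `K` pages, exactly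
`(x.2 \ x.1).card` are left out, and each page of the pool is equally likely to be one of them. -/
theorem missProb_of_old (hx : x.IsValid K) (hp : p ∈ x.1 \ x.2) :
    missProb K x p = (x.2 \ x.1).card / (x.1 \ x.2).card := by
  have h1 : K - x.2.card ≤ (x.1 \ x.2).card := by
    have := Finset.le_card_sdiff x.2 x.1
    rwa [hx.1] at this
  have h2 : (x.1 \ x.2).card - (K - x.2.card) = (x.2 \ x.1).card := by
    have e1 := Finset.card_sdiff_add_card_inter x.1 x.2
    have e2 := Finset.card_sdiff_add_card_inter x.2 x.1
    rw [Finset.inter_comm] at e2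
    have := hx.1
    have := hx.2
    omega
  have h3 := card_filter_notMem_top h1 hp
  rw [h2] at h3
  have h4 : ∀ π : Equiv.Perm (Fin N),
      p ∉ content K π x ↔ p ∉ top π (K - x.2.card) (x.1 \ x.2) := fun π => by
    simp [content, (Finset.mem_sdiff.1 hp).2]
  have hpos : 0 < (x.1 \ x.2).card := Finset.card_pos.2 ⟨p, hp⟩
  have hpos' : 0 < Fintype.card (Equiv.Perm (Fin N)) := Fintype.card_pos
  unfold missProb
  simp only [h4]
  rw [div_eq_div_iff (by positivity) (by positivity)]
  norm_cast
  linarith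

/-- The expected number of misses when the given pages are requested one by one. -/
noncomputable def expMisses (K : ℕ) : Phase N → List (Fin N) → ℝ
  | _, [] => 0
  | x, p :: ps => missProb K x p + expMisses K (mark K x p) ps

/-- A union bound over the pages: as long as the pages met are present, marking them does not change
the cache, so the first absent page is still absent when its turn comes. -/
theorem missProb_le_expMisses_foldl (hx : x.IsValid K) (hK : 0 < K) (ps : List (Fin N)) :
    ((Finset.univ.filter fun π : Equiv.Perm (Fin N) => ∃ p ∈ ps, p ∉ content K π x).card : ℝ) /
      Fintype.card (Equiv.Perm (Fin N)) ≤ expMisses K x ps := by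
  induction ps generalizing x with
  | nil => simp [expMisses]
  | cons p ps ih =>
    refine le_trans ?_ (add_le_add_right (ih (hx.mark (p := p) hK)) _)
    rw [missProb, ← add_div]
    gcongr
    norm_cast
    refine (Finset.card_le_card fun π hπ => ?_).trans (Finset.card_union_le _ _)
    simp only [Finset.mem_filter, Finset.mem_univ, true_and, Finset.mem_union,
      List.mem_cons, exists_eq_or_imp] at hπ ⊢
    by_cases h : p ∈ content K π x
    · rw [content_mark_of_mem hx hK π h]
      tauto
    · exact Or.inl h

end Marking

/-! ### The potential argument against an offline cache of size `k`. -/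

namespace Marking

variable {N K k g l : ℕ} {Y : ℝ} {x : Phase N} {D : PageSet N} {φ : ℝ}

/-- The number of misses when the given queries are served from state `x`. -/
noncomputable def misses (K : ℕ) (π : Equiv.Perm (Fin N)) : Phase N → List (PageSet N) → ℕ
  | _, [] => 0
  | x, Q :: σ => SingleCache.missCost (content K π x) Q +
      misses K π ((pages Q).foldl (mark K) x) σ

theorem costFrom_alg (hK : 0 < K) (hl : l ≤ K) (π : Equiv.Perm (Fin N)) (S₀ : PageSet N)
    (hS₀ : S₀.card = K) (σ : List (PageSet N)) (x : (alg hK hl π S₀ hS₀).State) :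
    (alg hK hl π S₀ hS₀).costFrom x σ = misses K π x.1 σ := by
  induction σ generalizing x with
  | nil => rfl
  | cons Q σ ih => exact congrArg (SingleCache.missCost (content K π x.1) Q + ·) (ih _)

theorem average_missCost_le (hx : x.IsValid K) (hK : 0 < K) (Q : PageSet N) :
    (∑ π : Equiv.Perm (Fin N), (SingleCache.missCost (content K π x) Q : ℝ)) /
      Fintype.card (Equiv.Perm (Fin N)) ≤ expMisses K x (pages Q) := by
  refine le_of_eq_of_le ?_ (missProb_le_expMisses_foldl hx hK (pages Q))
  congr 1
  rw [Finset.card_filter, Nat.cast_sum]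
  refine Finset.sum_congr rfl fun π _ => ?_
  unfold SingleCache.missCost
  simp only [mem_pages, ← Finset.not_subset]
  by_cases h : Q ⊆ content K π x <;> simp [h]

/-- An upper bound on the expected number of misses in the present phase. -/
noncomputable def accrued (K : ℕ) (x : Phase N) : ℝ :=
  (x.2 \ x.1).card * (1 + harmonic K - harmonic (x.1 \ x.2).card)

theorem harmonic_mono : Monotone harmonic :=
  monotone_nat_of_le_succ fun n => by
    rw [harmonic_succ]
    exact le_add_of_nonneg_right (by positivity)

theorem harmonic_nonneg (n : ℕ) : 0 ≤ harmonic n := by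
  simpa using harmonic_mono (Nat.zero_le n)

/-- Sum `1 / (m + 1) ≤ log ((m + 1) / m)` from `n` to `K - 1`. -/
theorem harmonic_sub_le_log {n : ℕ} (hn : 0 < n) (hnK : n ≤ K) :
    (harmonic K - harmonic n : ℝ) ≤ Real.log (K / n) := by
  have hn' : (0 : ℝ) < n := by exact_mod_cast hn
  induction K, hnK using Nat.le_induction with
  | base => simp
  | succ m hm ih =>
    have hm' : (0 : ℝ) < m := by exact_mod_cast hn.trans_le hm
    have h := Real.one_sub_inv_le_log_of_pos (x := (m + 1 : ℝ) / m) (by positivity)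
    have e1 : (1 : ℝ) - ((m + 1 : ℝ) / m)⁻¹ = (m + 1 : ℝ)⁻¹ := by field_simp; ring
    have e2 : ((m + 1 : ℕ) : ℝ) / n = (m / n) * ((m + 1 : ℝ) / m) := by
      push_cast; field_simp
    rw [e2, Real.log_mul (by positivity) (by positivity), harmonic_succ]
    push_cast
    linarith

theorem one_le_accrued_sub (hx : x.IsValid K) {p : Fin N} (hp : p ∉ x.2) (hpO : p ∉ x.1) :
    1 ≤ accrued K (x.1, insert p x.2) - accrued K x := by
  have h1 : insert p x.2 \ x.1 = insert p (x.2 \ x.1) := Finset.insert_sdiff_of_notMem _ hpO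
  have h2 : x.1 \ insert p x.2 = x.1 \ x.2 := by
    rw [Finset.sdiff_insert, Finset.erase_eq_of_notMem (by simp [hpO])]
  have h3 : (harmonic (x.1 \ x.2).card : ℝ) ≤ harmonic K := by
    exact_mod_cast harmonic_mono ((Finset.card_le_card Finset.sdiff_subset).trans hx.1.le)
  simp only [accrued, h1, h2]
  rw [Finset.card_insert_of_notMem (by simp [hp])]
  push_cast
  linarith

/-- For an old page the pool shrinks from `b + 1` to `b`, and `accrued` grows by `|M \ O| / (b +
1)`, which is exactly its miss probability. A new page adds at least `1`, enough for a certain miss.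
-/
theorem missProb_le_accrued_sub (hx : x.IsValid K) {p : Fin N} (hp : p ∉ x.2) :
    missProb K x p ≤ accrued K (x.1, insert p x.2) - accrued K x := by
  by_cases hpO : p ∈ x.1
  · have hmem : p ∈ x.1 \ x.2 := Finset.mem_sdiff.2 ⟨hpO, hp⟩
    rw [missProb_of_old hx hmem]
    have h1 : insert p x.2 \ x.1 = x.2 \ x.1 := Finset.insert_sdiff_of_mem _ hpO
    have h2 : x.1 \ insert p x.2 = (x.1 \ x.2).erase p := Finset.sdiff_insert _ _ _
    obtain ⟨b, hb⟩ := Nat.exists_eq_succ_of_ne_zero (Finset.card_ne_zero_of_mem hmem)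
    simp only [accrued, h1, h2, Finset.card_erase_of_mem hmem, hb, Nat.succ_eq_add_one,
      Nat.add_sub_cancel, harmonic_succ]
    push_cast
    apply le_of_eq
    ring
  · exact missProb_le_one.trans (one_le_accrued_sub hx hp hpO)

theorem accrued_le (hx : x.IsValid K) : accrued K x ≤ K * (1 + harmonic K) := by
  have h1 : ((x.2 \ x.1).card : ℝ) ≤ K := by
    exact_mod_cast (Finset.card_le_card Finset.sdiff_subset).trans hx.2
  have h2 : (0 : ℝ) ≤ harmonic (x.1 \ x.2).card := by exact_mod_cast harmonic_nonneg _
  have h3 : (harmonic (x.1 \ x.2).card : ℝ) ≤ harmonic K := by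
    exact_mod_cast harmonic_mono ((Finset.card_le_card Finset.sdiff_subset).trans hx.1.le)
  unfold accrued
  gcongr <;> linarith

/-- `φ` is large enough a credit for the marking algorithm in state `x` when the offline cache
contains `D`. Here `L` bounds the number of pages that the offline algorithm has loaded in the
present phase, and `d` is the number of its pages outside the previous phase at the beginning
of the present one. -/
def IsCredit (K g : ℕ) (Y : ℝ) (x : Phase N) (D : PageSet N) (φ : ℝ) : Prop :=
  ∃ L d : ℕ, ((x.2 ∪ D) \ x.1).card ≤ L + d ∧ (x.2 \ D).card ≤ L ∧
    Y * (g + d) + 2 * Y * L - accrued K x ≤ φ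

namespace IsCredit

theorem init (hY : 0 ≤ Y) (S₀ : PageSet N) (hD : D.card = k) :
    IsCredit K g Y (S₀, ∅) D (Y * (g + k)) := by
  refine ⟨0, (D \ S₀).card, by simp, by simp, ?_⟩
  have : ((D \ S₀).card : ℝ) ≤ k := by
    exact_mod_cast hD ▸ Finset.card_le_card Finset.sdiff_subset
  simp only [accrued, Finset.empty_sdiff, Finset.card_empty, Nat.cast_zero, zero_mul, sub_zero,
    mul_zero, add_zero]
  gcongr

/-- The credit may become negative, but only by what is accrued in a single phase; this enters the
additive constant. -/
theorem neg_le (h : IsCredit K g Y x D φ) (hY : 0 ≤ Y) (hx : x.IsValid K) :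
    -(K * (1 + harmonic K)) ≤ φ := by
  obtain ⟨L, d, -, -, h⟩ := h
  have h1 := accrued_le hx
  have : 0 ≤ Y * (g + d) + 2 * Y * L := by positivity
  linarith

/-- Each loaded page raises `L` by one. As `D` and `D'` have equal size, as many pages are evicted
as loaded, so the bound on marked pages outside the offline cache survives too. -/
theorem load (h : IsCredit K g Y x D φ) {D' : PageSet N} (hD : D'.card = D.card) :
    IsCredit K g Y x D' (φ + 2 * Y * (D' \ D).card) := by
  obtain ⟨L, d, h1, h2, h3⟩ := h
  refine ⟨L + (D' \ D).card, d, ?_, ?_, by push_cast; linarith⟩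
  · have hsub : (x.2 ∪ D') \ x.1 ⊆ ((x.2 ∪ D) \ x.1) ∪ (D' \ D) := by
      intro q; simp; tauto
    have := (Finset.card_le_card hsub).trans (Finset.card_union_le _ _)
    omega
  · have hsub : x.2 \ D' ⊆ (x.2 \ D) ∪ (D \ D') := by
      intro q; simp; tauto
    have h4 := (Finset.card_le_card hsub).trans (Finset.card_union_le _ _)
    have h5 := Finset.card_sdiff_add_card_inter D D'
    have h6 := Finset.card_sdiff_add_card_inter D' D
    rw [Finset.inter_comm] at h6
    omega

theorem insert (h : IsCredit K g Y x D φ) {p : Fin N} (hpD : p ∈ D) {c : ℝ}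
    (hc : c ≤ accrued K (x.1, insert p x.2) - accrued K x) :
    IsCredit K g Y (x.1, insert p x.2) D (φ - c) := by
  obtain ⟨L, d, h1, h2, h3⟩ := h
  refine ⟨L, d, ?_, ?_, by linarith⟩
  · rwa [show (Insert.insert p x.2 ∪ D) = x.2 ∪ D by
      rw [Finset.insert_union, Finset.insert_eq_of_mem (Finset.mem_union_right _ hpD)]]
  · rwa [Finset.insert_sdiff_of_mem _ hpD]

/-- At the end of a phase `K` pages are marked and `D` has `K - g`, so `L ≥ |x.2 \ D| = g + d'` with
`d' = |D \ x.2|`. Of the credit `Y (g + d) + 2 Y L`, the part `Y (g + d + L)` covers the accrued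
misses, and the rest `Y L` is at least the opening credit `Y (g + d')` of the next phase. -/
theorem newPhase (h : IsCredit K g Y x D φ) (hY : 0 ≤ Y) (hx : x.IsValid K)
    (hD : D.card + g = K) (hxK : x.2.card = K)
    (hYK : ∀ n : ℕ, n ≤ K → n * (1 + harmonic K - harmonic n : ℝ) ≤ Y * (n + g)) :
    IsCredit K g Y (x.2, ∅) D φ := by
  obtain ⟨L, d, h1, h2, h3⟩ := h
  refine ⟨0, (D \ x.2).card, by simp, by simp, ?_⟩
  have e1 := Finset.card_sdiff_add_card_inter x.1 x.2
  have e2 := Finset.card_sdiff_add_card_inter x.2 x.1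
  have e3 := Finset.card_sdiff_add_card_inter x.2 D
  have e4 := Finset.card_sdiff_add_card_inter D x.2
  rw [Finset.inter_comm] at e2 e4
  have hxO := hx.1
  have hab : (x.1 \ x.2).card = (x.2 \ x.1).card := by omega
  have hgL : ((g + (D \ x.2).card : ℕ) : ℝ) ≤ L := by
    exact_mod_cast (by omega : g + (D \ x.2).card ≤ L)
  have hn : (x.2 \ x.1).card ≤ L + d :=
    (Finset.card_le_card (Finset.sdiff_subset_sdiff Finset.subset_union_left subset_rfl)).trans h1
  have hn' : ((x.2 \ x.1).card : ℝ) ≤ L + d := by exact_mod_cast hn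
  have hacc : accrued K x ≤ Y * ((L + d) + g) := by
    unfold accrued
    rw [hab]
    refine (hYK _ (by omega)).trans ?_
    gcongr
  have := mul_le_mul_of_nonneg_left hgL hY
  simp only [accrued, Finset.empty_sdiff, Finset.card_empty, Nat.cast_zero, zero_mul, sub_zero,
    mul_zero, add_zero]
  push_cast at this
  linarith

theorem mark (h : IsCredit K g Y x D φ) (hY : 0 ≤ Y) (hx : x.IsValid K)
    (hD : D.card + g = K)
    (hYK : ∀ n : ℕ, n ≤ K → n * (1 + harmonic K - harmonic n : ℝ) ≤ Y * (n + g))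
    {p : Fin N} (hpD : p ∈ D) : IsCredit K g Y (mark K x p) D (φ - missProb K x p) := by
  by_cases h1 : p ∈ x.2
  · rwa [mark_of_mem h1, missProb_of_marked h1, sub_zero]
  rcases lt_or_ge x.2.card K with h2 | h2
  · rw [mark_of_lt h1 h2]
    exact h.insert hpD (missProb_le_accrued_sub hx h1)
  · rw [mark_of_le h1 h2]
    have hxK := le_antisymm hx.2 h2
    -- The first page of the new phase is outside the previous one, so its `accrued` increment of at
    -- least `1` pays for a miss.
    exact (h.newPhase hY hx hD hxK hYK).insert hpD
      (missProb_le_one.trans (one_le_accrued_sub (x := (x.2, ∅)) ⟨hxK, by simp⟩ (by simp) h1))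

theorem foldl (h : IsCredit K g Y x D φ) (hY : 0 ≤ Y) (hx : x.IsValid K) (hK : 0 < K)
    (hD : D.card + g = K)
    (hYK : ∀ n : ℕ, n ≤ K → n * (1 + harmonic K - harmonic n : ℝ) ≤ Y * (n + g))
    (ps : List (Fin N)) (hps : ∀ p ∈ ps, p ∈ D) :
    IsCredit K g Y (ps.foldl (Marking.mark K) x) D (φ - expMisses K x ps) := by
  induction ps generalizing x φ with
  | nil => simpa [expMisses] using h
  | cons p ps ih =>
    have := ih (h.mark hY hx hD hYK (hps p (by simp))) (hx.mark hK)
      fun q hq => hps q (by simp [hq])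
    rwa [sub_sub] at this

end IsCredit

theorem card_sdiff_le_of_isUpdate {D Q D' : PageSet N} (h : SingleCache.IsUpdate D Q D')
    (hQ : Q.card ≤ l) : (D' \ D).card ≤ l * SingleCache.missCost D Q := by
  unfold SingleCache.IsUpdate at h
  unfold SingleCache.missCost
  split_ifs at h ⊢ with hQD
  · simp [h]
  · rw [mul_one]
    refine (Finset.card_le_card ?_).trans hQ
    intro q hq
    have := Finset.mem_union.1 (h.2 (Finset.mem_sdiff.1 hq).1)
    exact this.resolve_left (Finset.mem_sdiff.1 hq).2

theorem subset_of_isUpdate {D Q D' : PageSet N} (h : SingleCache.IsUpdate D Q D') :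
    Q ⊆ D' := by
  unfold SingleCache.IsUpdate at h
  split_ifs at h with hQD
  · rwa [h]
  · exact h.1

/-- The average number of misses of the marking algorithm is bounded in terms of the cost of any
offline schedule for a smaller cache. -/
theorem average_misses_le (hY : 0 ≤ Y) (hK : 0 < K) (hkg : k + g = K)
    (hYK : ∀ n : ℕ, n ≤ K → n * (1 + harmonic K - harmonic n : ℝ) ≤ Y * (n + g))
    (σ : List (PageSet N)) (hσ : ∀ Q ∈ σ, Q.card ≤ l) (C : ℕ → PageSet N)
    (hC : SingleCache.IsSchedule k σ C) (hx : x.IsValid K) (h : IsCredit K g Y x (C 0) φ) :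
    (∑ π : Equiv.Perm (Fin N), (misses K π x σ : ℝ)) / Fintype.card (Equiv.Perm (Fin N)) ≤
      φ + 2 * l * Y * SingleCache.scheduleCost σ C + K * (1 + harmonic K) := by
  induction σ generalizing C x φ with
  | nil =>
    have := h.neg_le hY hx
    simp only [misses, SingleCache.scheduleCost]
    simp
    linarith
  | cons Q σ ih =>
    have hQ := hσ Q (by simp)
    have hu : SingleCache.IsUpdate (C 0) Q (C 1) := hC.2 0 (by simp)
    -- The offline cache moves first, so that all pages of `Q` lie in it while they are being
    -- marked.
    have hload := h.load ((hC.1 1).trans (hC.1 0).symm)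
    have hfold := hload.foldl hY hx hK (by rw [hC.1 1, hkg]) hYK (pages Q)
      fun p hp => subset_of_isUpdate hu (mem_pages.1 hp)
    have hrest := ih (fun P hP => hσ P (by simp [hP])) (fun t => C (t + 1))
      ⟨fun t => hC.1 _, fun t ht => hC.2 (t + 1) (by simpa using ht)⟩
      (hx.foldl hK (pages Q)) hfold
    have hstep := average_missCost_le hx hK Q
    have hcost : SingleCache.scheduleCost (Q :: σ) C =
        SingleCache.missCost (C 0) Q + SingleCache.scheduleCost σ fun t => C (t + 1) := by
      unfold SingleCache.scheduleCost
      exact Fin.sum_univ_succ _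
    have hl : (((C 1) \ (C 0)).card : ℝ) ≤ l * SingleCache.missCost (C 0) Q := by
      exact_mod_cast card_sdiff_le_of_isUpdate hu hQ
    have hl' := mul_le_mul_of_nonneg_left hl (by positivity : 0 ≤ 2 * Y)
    simp only [misses, Nat.cast_add, Finset.sum_add_distrib, add_div, hcost]
    linarith

end Marking

/-! ### Estimates for the constant `Y`. -/

namespace Real

/-- The tangent of `log` at `3` bounds `log (log a)` by `log a / 3 - 1 + log 3`. This crude lower
bound for `Y` suffices for `log_le_add_log`, where `log Y ≥ log (log a) - 1/2` is needed and `log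
(2/3) ≥ -1/2`. -/
theorem two_thirds_log_le {a : ℝ} (ha : 1 < a) :
    2 / 3 * log a ≤ log (2 * a + 1) - log (log a) + 1 / 2 := by
  have ht : 0 < log a := log_pos ha
  have h1 : log 2 + log a ≤ log (2 * a + 1) := by
    rw [← log_mul (by norm_num) (by positivity)]
    exact log_le_log (by positivity) (by linarith)
  have h2 : log (log a) - log 3 ≤ log a / 3 - 1 := by
    rw [← log_div ht.ne' (by norm_num)]
    exact log_le_sub_one_of_pos (by positivity)
  have h3 : log 3 - log 2 ≤ 3 / 2 - 1 := by
    rw [← log_div (by norm_num) (by norm_num)]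
    exact log_le_sub_one_of_pos (by norm_num)
  linarith

theorem log_le_add_log {a : ℝ} (ha : 1 < a) :
    log (2 * a + 1) ≤ log (2 * a + 1) - log (log a) + 1 / 2 +
      log (log (2 * a + 1) - log (log a) + 1 / 2) := by
  have ht : 0 < log a := log_pos ha
  have h1 := log_le_log (by positivity) (two_thirds_log_le ha)
  rw [log_mul (by norm_num) ht.ne'] at h1
  have h2 : -log (2 / 3) ≤ 3 / 2 - 1 := by
    rw [← log_inv]
    exact (log_le_sub_one_of_pos (by norm_num)).trans (by norm_num)
  linarith

/-- Split `K / n ≤ a * (g / n)`. The factor `a` is absorbed by `Y + log Y`, and `log (Y * g / n) ≤ Y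
* g / n - 1` cancels the leading `1`. -/
theorem mul_one_add_log_le {n g K a Y : ℝ} (hn : 0 < n) (hg : 0 < g) (hK : 0 < K)
    (ha : 0 < a) (hKg : K ≤ a * g) (hY : 0 < Y) (haY : log a ≤ Y + log Y) :
    n * (1 + log (K / n)) ≤ Y * (n + g) := by
  have h1 : log (K / n) ≤ log a + log (g / n) := by
    rw [← log_mul ha.ne' (by positivity)]
    refine log_le_log (by positivity) ?_
    rw [← mul_div_assoc]
    gcongr
  have h2 : log Y + log (g / n) ≤ Y * (g / n) - 1 := by
    rw [← log_mul hY.ne' (by positivity)]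
    exact log_le_sub_one_of_pos (by positivity)
  calc n * (1 + log (K / n)) ≤ n * (Y + Y * (g / n)) := mul_le_mul_of_nonneg_left (by linarith) hn.le
    _ = Y * (n + g) := by field_simp

end Real

/-! ### Assembly. -/

theorem theorem5 (N k l : ℕ) (hl : 2 ≤ l) (hlk : l ≤ k) (hkN : k ≤ N) :
    ∃ A : Distributed.RandAlg N (l + 1) k l,
      A.HasCompetitiveRatio
        (2 * l * (Real.log (2 * l + 1) - Real.log (Real.log l) + 1 / 2)) := by
  have hl1 : (1 : ℝ) < l := by exact_mod_cast hl
  have hlog := Real.log_pos hl1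
  have hYlog := Real.two_thirds_log_le hl1
  have haY := Real.log_le_add_log hl1
  set Y : ℝ := Real.log (2 * l + 1) - Real.log (Real.log l) + 1 / 2
  have hY : 0 < Y := by linarith
  -- If `N` is this small, a large cache of size `N` holds all pages and never misses. Otherwise
  -- there are enough pages to fill one of size `k + k / l`.
  rcases le_or_gt N (k + k / l) with hN | hN
  · obtain ⟨g, rfl⟩ := Nat.exists_eq_add_of_le hkN
    have hg : l * g ≤ k :=
      (Nat.mul_le_mul_left l (by omega : g ≤ k / l)).trans (Nat.mul_div_le k l)
    let A : SingleCache.OnlineAlg (k + g) (k + g) l :=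
      { State := Unit
        init := ()
        content := fun _ => Finset.univ
        step := fun _ _ => ()
        card_content := fun _ => by simp
        isUpdate := fun _ Q _ => by simp [SingleCache.IsUpdate] }
    have hA : ∀ σ, A.costFrom A.init σ = 0 := by
      intro σ
      induction σ with
      | nil => rfl
      | cons Q σ ih =>
        simp only [SingleCache.OnlineAlg.costFrom]
        rw [show A.step A.init Q = A.init from rfl, ih]
        simp [SingleCache.missCost, A]
    obtain ⟨B, hB⟩ := SingleCache.OnlineAlg.exists_randAlg (Ω := Unit) hg (fun _ => A)
      Finset.univ fun _ => rfl
    refine ⟨B, 0, fun σ hσ => ?_⟩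
    rw [hB σ hσ]
    simp only [hA]
    simp
    positivity
  · set g := k / l
    have hg : l * g ≤ k := Nat.mul_div_le k l
    have hgpos : 0 < g := Nat.div_pos hlk (by omega)
    have hklt : k < l * (g + 1) := Nat.lt_mul_div_succ k (by omega)
    -- From `k < l * (g + 1)` and `g ≥ 1` one gets `k ≤ 2 * l * g`; this is the origin of `2l + 1`
    -- in the ratio.
    have hKg : k + g ≤ (2 * l + 1) * g := by nlinarith
    have hK : 0 < k + g := by omega
    obtain ⟨S₀, -, hS₀⟩ := Finset.exists_subset_card_eq
      (s := (Finset.univ : PageSet N)) (n := k + g) (by simpa using hN.le)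
    obtain ⟨B, hB⟩ := SingleCache.OnlineAlg.exists_randAlg hg
      (fun π => Marking.alg (l := l) hK (by omega) π S₀ hS₀) S₀
      fun π => Marking.content_init hK _ π S₀ hS₀
    have hYK : ∀ n : ℕ, n ≤ k + g →
        n * (1 + harmonic (k + g) - harmonic n : ℝ) ≤ Y * (n + g) := by
      intro n hn
      rcases Nat.eq_zero_or_pos n with rfl | hn0
      · simp only [Nat.cast_zero, zero_mul, zero_add]
        positivity
      · refine le_trans ?_ (Real.mul_one_add_log_le (K := ((k + g : ℕ) : ℝ))
          (by exact_mod_cast hn0) (by exact_mod_cast hgpos) (by exact_mod_cast hK)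
          (by positivity) (by exact_mod_cast hKg) hY haY)
        rw [add_sub_assoc]
        gcongr
        exact Marking.harmonic_sub_le_log hn0 hn
    -- The additive constant is the initial credit plus the largest possible deficit in
    -- `IsCredit.neg_le`.
    refine ⟨B, Y * (g + k) + (k + g : ℕ) * (1 + harmonic (k + g)), fun σ hσ => ?_⟩
    obtain ⟨C, hC, hcost⟩ :=
      SingleCache.exists_scheduleCost_eq_opt hkN σ fun Q hQ => (hσ Q hQ).trans hlk
    have hmain := Marking.average_misses_le hY.le hK rfl hYK σ hσ C hC
      (x := (S₀, ∅)) ⟨hS₀, by simp⟩ (Marking.IsCredit.init hY.le S₀ (hC.1 0))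
    rw [hB σ hσ]
    refine ⟨ENNReal.ofReal_ne_top, ?_⟩
    rw [ENNReal.toReal_ofReal (by positivity)]
    simp only [Marking.costFrom_alg]
    rw [hcost] at hmain
    refine hmain.trans (le_of_eq ?_)
    ring
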